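/- Write $(a)_k=a(a+1)\cdots(a+k-1)$ for the rising factorial. For every integer $k\ge 1$, $$\sum_{n\ge 0}\frac{\left[\frac{1}{4^n}\binom{2n}{n}\right]^3}{(n+1)_k\left(\frac12-n\right)_k}=\frac{\Gamma\left(\frac14\right)^2}{2\pi\sqrt2}\cdot\frac{\Gamma\left(k+\frac14\right)}{\Gamma\left(k+\frac12\right)^2\,\Gamma\left(k+\frac34\right)},\qquad \sum_{n\ge 0}\frac{\left[\frac{1}{4^n}\binom{2n}{n}\right]^2}{(n+1)_k\left(\frac12-n\right)_k}=\frac{2^{8k-3}\,\Gamma(k)^2}{\pi\,\Gamma(4k)},$$ both series being convergent. Additionally, let $p(x)\in\mathbb{Q}[x]$ be a nonzero polynomial of even degree, all of whose complex roots are simple and belong to $\left\{\ldots,-3,-2,-1,\frac12,\frac32,\frac52,\ldots\right\}$, and such that $p(x)=p\left(-\frac12-x\right)$. Then $$\sum_{n\ge 0}\frac{1}{p(n)}\left[\frac{1}{4^n}\binom{2n}{n}\right]^3$$ converges to a rational multiple of $\frac{\Gamma(1/4)^4}{8\pi^3}$, and, if $p$ is not constant, $$\sum_{n\ge 0}\frac{1}{p(n)}\left[\frac{1}{4^n}\binom{2n}{n}\right]^2$$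 converges to a rational multiple of $\frac1\pi$. -/

import Mathlib

/-- The normalized central binomial coefficient `C(2n, n) / 4 ^ n`. -/
noncomputable def centralRatio (n : ℕ) : ℝ := (Nat.choose (2 * n) n : ℝ) / 4 ^ n

/-- The rising factorial `(a)_k = a (a + 1) ⋯ (a + k - 1)`. -/
noncomputable def risingFactorial (a : ℝ) (k : ℕ) : ℝ := (ascPochhammer ℝ k).eval a

/-- The set `{…, -3, -2, -1, 1/2, 3/2, 5/2, …}`. -/
def admissibleRoots : Set ℂ :=
  {z | (∃ m : ℕ, z = -((m : ℂ) + 1)) ∨ (∃ m : ℕ, z = (m : ℂ) + 1 / 2)}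

/-- Nonzero polynomials of even degree, all of whose complex roots are simple and lie in
`admissibleRoots`, and with `p(x) = p(-1/2 - x)`. -/
structure IsAdmissible (p : Polynomial ℚ) : Prop where
  ne_zero : p ≠ 0
  even_degree : Even p.natDegree
  simple_roots : (p.aroots ℂ).Nodup
  roots_mem : ∀ z ∈ p.aroots ℂ, z ∈ admissibleRoots
  symmetric : p.comp (Polynomial.C (-1 / 2) - Polynomial.X) = p

/-!
Gauss's and Dixon's summation theorems both follow from a contiguous relation: when a parameter is
shifted, the series changes by an explicit rational factor, because the difference of the terms
telescopes. As the shift is iterated the series tends to its first term `1`, and the product of the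
factors is a quotient of Gamma values. Since `C(2n, n) / 4 ^ n = (1/2)_n / n!`, the sums with
denominator `(n + 1)_k (1/2 - n)_k` are the cases `₃F₂(1/2, 1/2, 1/2 - k; 1, k + 1; 1)` and
`₂F₁(1/2, 1/2 - k; k + 1; 1)`.

The `m`-th factor of `(n + 1)_k (1/2 - n)_k` is `e m - n (n + 1/2)` with `e m = (m + 1)(m + 1/2)`,
and an admissible polynomial is, up to a constant, a product of such factors over a finite set of
`m`. The resolvent identity `r i - r j = (e j - e i) r i r j` for their reciprocals writes `1 / p`
as a rational combination of the reciprocals of `(n + 1)_k (1/2 - n)_k`, with `k ≥ 1` unless `p` is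
constant.
-/

section RisingFactorial

theorem risingFactorial_zero (a : ℝ) : risingFactorial a 0 = 1 := by
  rw [risingFactorial, ascPochhammer_zero, Polynomial.eval_one]

theorem risingFactorial_succ (a : ℝ) (k : ℕ) :
    risingFactorial a (k + 1) = risingFactorial a k * (a + k) :=
  ascPochhammer_succ_eval k a

theorem risingFactorial_eq_prod_range (a : ℝ) (k : ℕ) :
    risingFactorial a k = ∏ i ∈ Finset.range k, (a + i) := by
  induction k with
  | zero => rw [risingFactorial_zero, Finset.prod_range_zero]
  | succ k ih => rw [risingFactorial_succ, ih, Finset.prod_range_succ]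

theorem risingFactorial_add (a : ℝ) (m k : ℕ) :
    risingFactorial a (m + k) = risingFactorial a m * risingFactorial (a + m) k := by
  simp only [risingFactorial_eq_prod_range, Finset.prod_range_add, Nat.cast_add, add_assoc]

theorem risingFactorial_add_one_mul (a : ℝ) (k : ℕ) :
    risingFactorial (a + 1) k * a = risingFactorial a k * (a + k) := by
  rw [← risingFactorial_succ, add_comm k 1, risingFactorial_add, risingFactorial_succ,
    risingFactorial_zero]
  push_cast
  ring

theorem risingFactorial_sub_natCast_mul (a : ℝ) (k n : ℕ) :
    risingFactorial (a - n) k * risingFactorial (1 - a - k) n =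
      risingFactorial a k * risingFactorial (1 - a) n := by
  induction n with
  | zero => simp only [risingFactorial_zero, Nat.cast_zero, sub_zero]
  | succ n ih =>
    have hshift := risingFactorial_add_one_mul (a - (n + 1 : ℕ)) k
    rw [show a - (n + 1 : ℕ) + 1 = a - n by push_cast; ring] at hshift
    rw [risingFactorial_succ, risingFactorial_succ]
    push_cast at hshift ⊢
    linear_combination (1 - a + n) * ih + risingFactorial (1 - a - k) n * hshift

theorem ne_neg_natCast_of_pos {a : ℝ} (ha : 0 < a) (m : ℕ) : a ≠ -m := by
  have : (0 : ℝ) ≤ m := m.cast_nonneg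
  linarith

theorem add_natCast_ne_zero {a : ℝ} (ha : ∀ m : ℕ, a ≠ -m) (n : ℕ) : a + n ≠ 0 :=
  fun h => ha n (eq_neg_of_add_eq_zero_left h)

theorem add_natCast_ne_neg_natCast {a : ℝ} (ha : ∀ m : ℕ, a ≠ -m) (n m : ℕ) : a + n ≠ -m :=
  fun h => ha (n + m) (by push_cast; linarith)

theorem risingFactorial_ne_zero {a : ℝ} (ha : ∀ m : ℕ, a ≠ -m) (k : ℕ) :
    risingFactorial a k ≠ 0 := by
  rw [risingFactorial_eq_prod_range]
  exact Finset.prod_ne_zero_iff.mpr fun i _ => add_natCast_ne_zero ha i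

theorem risingFactorial_add_two {a : ℝ} (ha : ∀ m : ℕ, a ≠ -m) (k : ℕ) :
    risingFactorial (a + 2) k =
      risingFactorial a k * ((a + k) * (a + 1 + k) / (a * (a + 1))) := by
  have ha₀ : a ≠ 0 := by simpa using ha 0
  have ha₁ : a + 1 ≠ 0 := by simpa using add_natCast_ne_zero ha 1
  have h₁ := risingFactorial_add_one_mul a k
  have h₂ := risingFactorial_add_one_mul (a + 1) k
  rw [add_assoc, one_add_one_eq_two] at h₂
  field_simp
  linear_combination a * h₂ + (a + 1 + k) * h₁

theorem Gamma_add_natCast {a : ℝ} (ha : ∀ m : ℕ, a ≠ -m) (k : ℕ) :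
    Real.Gamma (a + k) = risingFactorial a k * Real.Gamma a := by
  induction k with
  | zero => rw [risingFactorial_zero, Nat.cast_zero, add_zero, one_mul]
  | succ k ih =>
    rw [Nat.cast_succ, ← add_assoc, Real.Gamma_add_one (add_natCast_ne_zero ha k), ih,
      risingFactorial_succ]
    ring

theorem risingFactorial_ratCast (x : ℚ) (k : ℕ) :
    risingFactorial (x : ℝ) k = ((ascPochhammer ℚ k).eval x : ℚ) := by
  rw [risingFactorial, ← ascPochhammer_map (algebraMap ℚ ℝ), ← eq_ratCast (algebraMap ℚ ℝ) x,
    Polynomial.eval_map_apply, eq_ratCast]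

end RisingFactorial

section HypergeometricTerm

open Filter Topology
open scoped Nat

-- At a pole `a = -m` both `Γ(a)` and its Euler approximations have the value `0`, so that no
-- exception is needed for the entire function `1 / Γ`.
theorem tendsto_inv_GammaSeq (a : ℝ) :
    Tendsto (fun n => (Real.GammaSeq a n)⁻¹) atTop (𝓝 (Real.Gamma a)⁻¹) := by
  by_cases h : Real.Gamma a = 0
  · obtain ⟨m, rfl⟩ := (Real.Gamma_eq_zero_iff a).mp h
    rw [h]
    refine tendsto_const_nhds.congr' ?_
    filter_upwards [eventually_ge_atTop m] with n hn
    rw [Real.GammaSeq, Finset.prod_eq_zero (Finset.mem_range_succ_iff.mpr hn) (neg_add_cancel _),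
      div_zero]
  · exact (Real.GammaSeq_tendsto_Gamma a).inv₀ h

theorem tendsto_risingFactorial_div (a : ℝ) :
    Tendsto (fun n : ℕ => risingFactorial a n / (n ! * (n : ℝ) ^ (a - 1))) atTop
      (𝓝 (Real.Gamma a)⁻¹) := by
  have h := (tendsto_inv_GammaSeq a).mul (tendsto_natCast_div_add_atTop a)
  rw [mul_one] at h
  refine h.congr' ?_
  have hne : ∀ᶠ n : ℕ in atTop, (n : ℝ) + a ≠ 0 :=
    (tendsto_atTop_add_const_right _ a tendsto_natCast_atTop_atTop).eventually_ne_atTop 0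
  filter_upwards [eventually_gt_atTop 0, hne] with n hn hna
  have hn' : (0 : ℝ) < n := Nat.cast_pos.mpr hn
  have hpow : (n : ℝ) ^ a ≠ 0 := (Real.rpow_pos_of_pos hn' a).ne'
  rw [Real.GammaSeq, ← risingFactorial_eq_prod_range, risingFactorial_succ,
    Real.rpow_sub_one hn'.ne', add_comm a]
  field_simp

/-- The `n`-th term `∏ (x i)_n / ∏ (y i)_n` of a hypergeometric series at argument `1`. The
denominator parameter `1`, which gives the factor `n!`, has to be listed among the `y i`. -/
noncomputable def hypergeometricTerm {ι : Type*} [Fintype ι] (x y : ι → ℝ) (n : ℕ) : ℝ :=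
  ∏ i, risingFactorial (x i) n / risingFactorial (y i) n

variable {ι : Type*} [Fintype ι] {x y : ι → ℝ}

theorem hypergeometricTerm_zero (x y : ι → ℝ) : hypergeometricTerm x y 0 = 1 := by
  simp only [hypergeometricTerm, risingFactorial_zero, div_one, Finset.prod_const_one]

theorem hypergeometricTerm_eq_prod_range (x y : ι → ℝ) (n : ℕ) :
    hypergeometricTerm x y n = ∏ j ∈ Finset.range n, ∏ i, (x i + j) / (y i + j) := by
  simp only [hypergeometricTerm, risingFactorial_eq_prod_range, ← Finset.prod_div_distrib]
  exact Finset.prod_comm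

theorem hypergeometricTerm_succ (x y : ι → ℝ) (n : ℕ) :
    hypergeometricTerm x y (n + 1) = hypergeometricTerm x y n * ∏ i, (x i + n) / (y i + n) := by
  simp only [hypergeometricTerm_eq_prod_range, Finset.prod_range_succ]

theorem tendsto_rpow_mul_hypergeometricTerm (hy : ∀ i, ∀ m : ℕ, y i ≠ -m) :
    Tendsto (fun n : ℕ => (n : ℝ) ^ (∑ i, (y i - x i)) * hypergeometricTerm x y n) atTop
      (𝓝 (∏ i, Real.Gamma (y i) / Real.Gamma (x i))) := by
  have h := tendsto_finsetProd Finset.univ fun i _ =>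
    (tendsto_risingFactorial_div (x i)).div (tendsto_risingFactorial_div (y i))
      (inv_ne_zero (Real.Gamma_ne_zero (hy i)))
  simp only [inv_div_inv] at h
  refine h.congr' ?_
  filter_upwards [eventually_gt_atTop 0] with n hn
  have hn' : (0 : ℝ) < n := Nat.cast_pos.mpr hn
  rw [hypergeometricTerm, Real.rpow_sum_of_pos hn', ← Finset.prod_mul_distrib]
  refine Finset.prod_congr rfl fun i _ => ?_
  have hpow : (n : ℝ) ^ (x i) ≠ 0 := (Real.rpow_pos_of_pos hn' _).ne'
  rw [Pi.div_apply, Real.rpow_sub_one hn'.ne', Real.rpow_sub_one hn'.ne', Real.rpow_sub hn']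
  field_simp [risingFactorial_ne_zero (hy i) n]

theorem tendsto_hypergeometricTerm_of_sum_eq (hy : ∀ i, ∀ m : ℕ, y i ≠ -m)
    (hxy : ∑ i, x i = ∑ i, y i) :
    Tendsto (hypergeometricTerm x y) atTop (𝓝 (∏ i, Real.Gamma (y i) / Real.Gamma (x i))) := by
  simpa only [Finset.sum_sub_distrib, hxy, sub_self, Real.rpow_zero, one_mul] using
    tendsto_rpow_mul_hypergeometricTerm (x := x) hy

theorem hypergeometricTerm_isBigO (hy : ∀ i, ∀ m : ℕ, y i ≠ -m) :
    hypergeometricTerm x y =O[atTop] fun n : ℕ => (n : ℝ) ^ (-∑ i, (y i - x i)) := by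
  have h := (Asymptotics.isBigO_refl (fun n : ℕ => (n : ℝ) ^ (-∑ i, (y i - x i))) atTop).mul
    ((tendsto_rpow_mul_hypergeometricTerm (x := x) hy).isBigO_one ℝ)
  refine h.congr' ?_ (Eventually.of_forall fun n => mul_one _)
  filter_upwards [eventually_gt_atTop 0] with n hn
  have hn' : (0 : ℝ) < n := Nat.cast_pos.mpr hn
  rw [← mul_assoc, ← Real.rpow_add hn', neg_add_cancel, Real.rpow_zero, one_mul]

theorem summable_hypergeometricTerm (hy : ∀ i, ∀ m : ℕ, y i ≠ -m) (hxy : 1 < ∑ i, (y i - x i)) :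
    Summable (hypergeometricTerm x y) :=
  summable_of_isBigO_nat (Real.summable_nat_rpow.mpr (neg_lt_neg hxy))
    (hypergeometricTerm_isBigO hy)

theorem tendsto_natCast_mul_hypergeometricTerm (hy : ∀ i, ∀ m : ℕ, y i ≠ -m)
    (hxy : 1 < ∑ i, (y i - x i)) :
    Tendsto (fun n : ℕ => n * hypergeometricTerm x y n) atTop (𝓝 0) := by
  have h := (Asymptotics.isBigO_refl (fun n : ℕ => (n : ℝ)) atTop).mul
    (hypergeometricTerm_isBigO (x := x) hy)
  refine h.trans_tendsto (((tendsto_rpow_neg_atTop (sub_pos.mpr hxy)).comp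
    tendsto_natCast_atTop_atTop).congr' ?_)
  filter_upwards [eventually_gt_atTop 0] with n hn
  have hn' : (0 : ℝ) < n := Nat.cast_pos.mpr hn
  rw [Function.comp_apply, neg_sub, sub_eq_add_neg, Real.rpow_add hn', Real.rpow_one]

end HypergeometricTerm

section ContiguousRelations

open Filter Topology

theorem hasSum_of_contiguous_relation {𝕜 : Type*} [NormedField 𝕜] [CompleteSpace 𝕜]
    {F G : ℕ → ℕ → 𝕜} {R g : ℕ → 𝕜} {B : ℕ → ℝ} {L : 𝕜} (hF : ∀ j, Summable (F j))
    (hFG : ∀ j n, F j n - R j * F (j + 1) n = G j (n + 1) - G j n) (hG₀ : ∀ j, G j 0 = 0)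
    (hG : ∀ j, Tendsto (G j) atTop (𝓝 0)) (hB : Summable B)
    (hFB : ∀ᶠ j in atTop, ∀ n, ‖F j n‖ ≤ B n) (hFg : ∀ n, Tendsto (F · n) atTop (𝓝 (g n)))
    (hR : Tendsto (fun N => ∏ j ∈ Finset.range N, R j) atTop (𝓝 L)) :
    HasSum (F 0) (L * ∑' n, g n) := by
  have hstep : ∀ j, ∑' n, F j n = R j * ∑' n, F (j + 1) n := fun j => by
    have hsum := (hF j).hasSum.sub ((hF (j + 1)).hasSum.mul_left (R j))
    have htele : Tendsto (fun N => ∑ n ∈ Finset.range N, (F j n - R j * F (j + 1) n)) atTop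
        (𝓝 0) := by
      simpa only [hFG, Finset.sum_range_sub, hG₀, sub_zero] using hG j
    exact sub_eq_zero.mp (tendsto_nhds_unique hsum.tendsto_sum_nat htele)
  have hiter : ∀ N, (∏ j ∈ Finset.range N, R j) * ∑' n, F N n = ∑' n, F 0 n := fun N => by
    induction N with
    | zero => rw [Finset.prod_range_zero, one_mul]
    | succ N ih => rw [Finset.prod_range_succ, mul_assoc, ← hstep, ih]
  have hlim := hR.mul (tendsto_tsum_of_dominated_convergence hB hFg hFB)
  simp only [hiter] at hlim
  rw [← tendsto_nhds_unique tendsto_const_nhds hlim]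
  exact (hF 0).hasSum

variable {ι κ : Type*} [Fintype ι] [Fintype κ]

theorem tendsto_hypergeometricTerm_pi_single {x y : ℕ → ι → ℝ}
    (h : ∀ n : ℕ, Tendsto (fun j => ∏ i, (x j i + n) / (y j i + n)) atTop (𝓝 0)) (n : ℕ) :
    Tendsto (fun j => hypergeometricTerm (x j) (y j) n) atTop
      (𝓝 (Pi.single (M := fun _ => ℝ) 0 1 n)) := by
  cases n with
  | zero =>
    simp only [hypergeometricTerm_zero, Pi.single_eq_same]
    exact tendsto_const_nhds
  | succ n =>
    rw [Pi.single_eq_of_ne n.succ_ne_zero]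
    simpa only [hypergeometricTerm_eq_prod_range, Finset.prod_const,
      Finset.card_range, zero_pow n.succ_ne_zero] using
      tendsto_finsetProd (Finset.range (n + 1)) fun m _ => h m

theorem hasSum_hypergeometricTerm_of_contiguous_relation {x y : ℕ → ι → ℝ} {p q : κ → ℝ}
    {C : ℕ → ℕ → ℝ} (hy : ∀ j i, ∀ m : ℕ, y j i ≠ -m) (hxy : ∀ j, 1 < ∑ i, (y j i - x j i))
    (hrel : ∀ j n, hypergeometricTerm (x j) (y j) n -
      (∏ i, (p i + j) / (q i + j)) * hypergeometricTerm (x (j + 1)) (y (j + 1)) n =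
        C j (n + 1) * ((n + 1 : ℕ) * hypergeometricTerm (x j) (y j) (n + 1)) -
          C j n * (n * hypergeometricTerm (x j) (y j) n))
    (hC : ∀ j, ∃ l, Tendsto (C j) atTop (𝓝 l))
    (hdom : ∃ J, ∀ j ≥ J, ∀ n : ℕ,
      |∏ i, (x j i + n) / (y j i + n)| ≤ |∏ i, (x J i + n) / (y J i + n)|)
    (hlim : ∀ n : ℕ, Tendsto (fun j => ∏ i, (x j i + n) / (y j i + n)) atTop (𝓝 0))
    (hq : ∀ i, ∀ m : ℕ, q i ≠ -m) (hpq : ∑ i, p i = ∑ i, q i) :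
    HasSum (hypergeometricTerm (x 0) (y 0)) (∏ i, Real.Gamma (q i) / Real.Gamma (p i)) := by
  obtain ⟨J, hJ⟩ := hdom
  have hF : ∀ j, Summable (hypergeometricTerm (x j) (y j)) := fun j =>
    summable_hypergeometricTerm (hy j) (hxy j)
  have hFB : ∀ᶠ j in atTop, ∀ n, ‖hypergeometricTerm (x j) (y j) n‖ ≤
      |hypergeometricTerm (x J) (y J) n| := by
    filter_upwards [eventually_ge_atTop J] with j hj n
    simp only [Real.norm_eq_abs, hypergeometricTerm_eq_prod_range, Finset.abs_prod (Finset.range n)]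
    exact Finset.prod_le_prod (fun m _ => abs_nonneg _) fun m _ => hJ j hj m
  have hG : ∀ j, Tendsto (fun n => C j n * (n * hypergeometricTerm (x j) (y j) n)) atTop
      (𝓝 0) := fun j => by
    obtain ⟨l, hl⟩ := hC j
    simpa only [mul_zero] using hl.mul (tendsto_natCast_mul_hypergeometricTerm (hy j) (hxy j))
  have hR := (tendsto_hypergeometricTerm_of_sum_eq hq hpq).congr
    (hypergeometricTerm_eq_prod_range p q)
  have h := hasSum_of_contiguous_relation hF hrel
    (fun j => by rw [Nat.cast_zero, zero_mul, mul_zero]) hG (hF J).abs hFB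
    (tendsto_hypergeometricTerm_pi_single hlim) hR
  rwa [tsum_pi_single, mul_one] at h

end ContiguousRelations

section GaussDixon

open Filter Topology

-- The telescoping certificate is the one found by Zeilberger's algorithm for the shift `c ↦ c + 1`.
theorem gauss_contiguous_relation {a b c : ℝ} (hc : ∀ m : ℕ, c ≠ -m) (h : c - a - b ≠ 0) (n : ℕ) :
    hypergeometricTerm ![a, b] ![c, 1] n -
      (c - a) * (c - b) / (c * (c - a - b)) * hypergeometricTerm ![a, b] ![c + 1, 1] n =
    -(c - a - b)⁻¹ * ((n + 1 : ℕ) * hypergeometricTerm ![a, b] ![c, 1] (n + 1)) -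
      -(c - a - b)⁻¹ * (n * hypergeometricTerm ![a, b] ![c, 1] n) := by
  have hc₀ : c ≠ 0 := by simpa using hc 0
  have hcn : c + n ≠ 0 := add_natCast_ne_zero hc n
  have hn : (1 : ℝ) + n ≠ 0 := by positivity
  have hshift : hypergeometricTerm ![a, b] ![c + 1, 1] n =
      c / (c + n) * hypergeometricTerm ![a, b] ![c, 1] n := by
    have : risingFactorial (c + 1) n = risingFactorial c n * (c + n) / c :=
      eq_div_of_mul_eq hc₀ (risingFactorial_add_one_mul c n)
    simp only [hypergeometricTerm, Fin.prod_univ_two, Matrix.cons_val_zero, Matrix.cons_val_one,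
      this]
    field
  rw [hypergeometricTerm_succ, hshift]
  simp only [Fin.prod_univ_two, Matrix.cons_val_zero, Matrix.cons_val_one]
  push_cast
  field

theorem hasSum_hypergeometricTerm_gauss {a b c : ℝ} (hc : ∀ m : ℕ, c ≠ -m) (h : a + b < c) :
    HasSum (hypergeometricTerm ![a, b] ![c, 1])
      (Real.Gamma c * Real.Gamma (c - a - b) / (Real.Gamma (c - a) * Real.Gamma (c - b))) := by
  have hexcess : ∀ j : ℕ, 0 < c + j - a - b := fun j => by linarith [j.cast_nonneg (α := ℝ)]
  have hratio : ∀ j n : ℕ, ∏ i, (![a, b] i + n) / ((![c + j, 1] : Fin 2 → ℝ) i + n) =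
      (a + n) * (b + n) / (1 + n) / (c + n + j) := fun j n => by
    simp only [Fin.prod_univ_two, Matrix.cons_val_zero, Matrix.cons_val_one]
    rw [add_right_comm c, div_mul_div_comm, div_div, mul_comm (1 + (n : ℝ))]
  have key := hasSum_hypergeometricTerm_of_contiguous_relation
    (x := fun _ => ![a, b]) (y := fun j => ![c + j, 1]) (p := ![c - a, c - b])
    (q := ![c, c - a - b]) (C := fun j _ => -(c + j - a - b)⁻¹) ?_ ?_ ?_ ?_ ?_ ?_ ?_ ?_
  · simpa [Fin.prod_univ_two, div_mul_div_comm] using key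
  · exact fun j => Fin.forall_fin_two.mpr
      ⟨add_natCast_ne_neg_natCast hc j, ne_neg_natCast_of_pos one_pos⟩
  · intro j
    simp only [Fin.sum_univ_two, Matrix.cons_val_zero, Matrix.cons_val_one]
    linarith [hexcess j]
  · intro j n
    rw [← gauss_contiguous_relation (add_natCast_ne_neg_natCast hc j) (hexcess j).ne',
      Fin.prod_univ_two, div_mul_div_comm]
    simp only [Matrix.cons_val_zero, Matrix.cons_val_one]
    push_cast
    ring_nf
  · exact fun j => ⟨_, tendsto_const_nhds⟩
  · obtain ⟨J, hJ⟩ := exists_nat_gt (-c)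
    refine ⟨J, fun j hj n => ?_⟩
    have hpos : 0 < c + n + J := by linarith [n.cast_nonneg (α := ℝ)]
    rw [hratio, hratio, abs_div _ (c + n + j), abs_div _ (c + n + J)]
    gcongr
  · intro n
    simp only [hratio]
    exact tendsto_const_nhds.div_atTop
      (tendsto_atTop_add_const_left _ _ tendsto_natCast_atTop_atTop)
  · exact Fin.forall_fin_two.mpr ⟨hc, ne_neg_natCast_of_pos (by simpa using hexcess 0)⟩
  · simp only [Fin.sum_univ_two, Matrix.cons_val_zero, Matrix.cons_val_one]
    ring

theorem dixonTerm_add_two {a b c : ℝ} (ha : ∀ m : ℕ, a ≠ -m) (hb : ∀ m : ℕ, 1 + a - b ≠ -m)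
    (hc : ∀ m : ℕ, 1 + a - c ≠ -m) (n : ℕ) :
    hypergeometricTerm ![a + 2, b, c] ![1 + (a + 2) - b, 1 + (a + 2) - c, 1] n =
      (a + n) * (a + 1 + n) / (a * (a + 1)) /
        ((1 + a - b + n) * (1 + a - b + 1 + n) / ((1 + a - b) * (1 + a - b + 1))) /
          ((1 + a - c + n) * (1 + a - c + 1 + n) / ((1 + a - c) * (1 + a - c + 1))) *
            hypergeometricTerm ![a, b, c] ![1 + a - b, 1 + a - c, 1] n := by
  simp only [hypergeometricTerm, Fin.prod_univ_three, Matrix.cons_val, risingFactorial_add_two ha,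
    show 1 + (a + 2) - b = 1 + a - b + 2 by ring, risingFactorial_add_two hb,
    show 1 + (a + 2) - c = 1 + a - c + 2 by ring, risingFactorial_add_two hc]
  simp only [div_eq_mul_inv, mul_inv, inv_inv]
  ring

/-- The rational function `C` for which `n * C n` times the `n`-th term of Dixon's series certifies
the contiguous relation under `a ↦ a + 2`, as found by Zeilberger's algorithm. -/
noncomputable def dixonCertificate (a b c n : ℝ) : ℝ :=
  -((a + n) * (a + n + 3 + a - 2 * b - 2 * c) - (2 + a - 2 * b - 2 * c) * (1 - b) * (1 - c) / a) /
    ((2 + a - 2 * b - 2 * c) * (1 + a - b + n) * (1 + a - c + n))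

theorem dixon_contiguous_relation {a b c : ℝ} (ha : ∀ m : ℕ, a ≠ -m)
    (hb : ∀ m : ℕ, 1 + a - b ≠ -m) (hc : ∀ m : ℕ, 1 + a - c ≠ -m)
    (h : 2 + a - 2 * b - 2 * c ≠ 0) (n : ℕ) :
    hypergeometricTerm ![a, b, c] ![1 + a - b, 1 + a - c, 1] n -
      (a + 1) * (2 + a - 2 * b) * (2 + a - 2 * c) * (1 + a - b - c) * (2 + a - b - c) /
        ((1 + a - b) * (1 + a - b + 1) * (1 + a - c) * (1 + a - c + 1) * (2 + a - 2 * b - 2 * c)) *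
        hypergeometricTerm ![a + 2, b, c] ![1 + (a + 2) - b, 1 + (a + 2) - c, 1] n =
    dixonCertificate a b c (n + 1 : ℕ) * ((n + 1 : ℕ) *
        hypergeometricTerm ![a, b, c] ![1 + a - b, 1 + a - c, 1] (n + 1)) -
      dixonCertificate a b c n * (n *
        hypergeometricTerm ![a, b, c] ![1 + a - b, 1 + a - c, 1] n) := by
  have ha₀ : a ≠ 0 := by simpa using ha 0
  have ha₁ : a + 1 ≠ 0 := by simpa using add_natCast_ne_zero ha 1
  have hb₀ : 1 + a - b ≠ 0 := by simpa using hb 0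
  have hc₀ : 1 + a - c ≠ 0 := by simpa using hc 0
  have hbn₀ : 1 + a - b + n ≠ 0 := add_natCast_ne_zero hb n
  have hbn₁ : 1 + a - b + 1 + n ≠ 0 := fun H => add_natCast_ne_zero hb (n + 1) (by
    push_cast; linarith)
  have hcn₀ : 1 + a - c + n ≠ 0 := add_natCast_ne_zero hc n
  have hcn₁ : 1 + a - c + 1 + n ≠ 0 := fun H => add_natCast_ne_zero hc (n + 1) (by
    push_cast; linarith)
  have hb₁ : 1 + a - b + 1 ≠ 0 := by simpa using add_natCast_ne_zero hb 1
  have hc₁ : 1 + a - c + 1 ≠ 0 := by simpa using add_natCast_ne_zero hc 1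
  have hn : (1 : ℝ) + n ≠ 0 := by positivity
  rw [dixonTerm_add_two ha hb hc, hypergeometricTerm_succ]
  generalize hypergeometricTerm ![a, b, c] ![1 + a - b, 1 + a - c, 1] n = t
  simp only [dixonCertificate, Fin.prod_univ_three, Matrix.cons_val]
  rw [show 1 + a - b + (n + 1 : ℕ) = 1 + a - b + 1 + n by push_cast; ring,
    show 1 + a - c + (n + 1 : ℕ) = 1 + a - c + 1 + n by push_cast; ring]
  push_cast
  field_simp
  ring

theorem tendsto_dixonCertificate (a b c : ℝ) :
    Tendsto (fun n : ℕ => dixonCertificate a b c n) atTop (𝓝 (-(2 + a - 2 * b - 2 * c)⁻¹)) := by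
  have hone : ∀ s t : ℝ, Tendsto (fun n : ℕ => (s + n) / (t + n)) atTop (𝓝 1) := fun s t => by
    simpa only [one_mul, div_one] using tendsto_add_mul_div_add_mul_atTop_nhds s t 1 one_ne_zero
  have hzero : ∀ t : ℝ, Tendsto (fun n : ℕ => 1 / (t + n)) atTop (𝓝 0) := fun t =>
    tendsto_const_nhds.div_atTop (tendsto_atTop_add_const_left _ _ tendsto_natCast_atTop_atTop)
  have h := ((((hone a (1 + a - b)).mul (hone (a + 3 + a - 2 * b - 2 * c) (1 + a - c))).sub
    (((hzero (1 + a - b)).mul (hzero (1 + a - c))).const_mul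
      ((2 + a - 2 * b - 2 * c) * (1 - b) * (1 - c) / a))).const_mul (-(2 + a - 2 * b - 2 * c)⁻¹))
  simp only [mul_one, mul_zero, sub_zero] at h
  refine h.congr fun n => ?_
  simp only [dixonCertificate, div_eq_mul_inv, mul_inv]
  ring

theorem antitoneOn_abs_div_add_mul_add (p q : ℝ) :
    AntitoneOn (fun z => |z / ((z + p) * (z + q))|) (Set.Ioi (|p| + |q|)) := by
  intro z hz w hw hzw
  rw [Set.mem_Ioi] at hz hw
  have hp := neg_abs_le p
  have hq := neg_abs_le q
  have hp' := abs_nonneg p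
  have hq' := abs_nonneg q
  have hden : ∀ v, |p| + |q| < v → 0 < (v + p) * (v + q) := fun v hv =>
    mul_pos (by linarith) (by linarith)
  have hpq : p * q ≤ z * w := (le_abs_self _).trans <| (abs_mul p q).trans_le <|
    mul_le_mul (by linarith) (by linarith) hq' (by linarith)
  simp only
  rw [abs_of_nonneg (div_nonneg (by linarith) (hden w hw).le),
    abs_of_nonneg (div_nonneg (by linarith) (hden z hz).le),
    div_le_div_iff₀ (hden w hw) (hden z hz)]
  linear_combination mul_nonneg (sub_nonneg.mpr hzw) (sub_nonneg.mpr hpq)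

theorem tendsto_div_add_mul_add_atTop (p q : ℝ) :
    Tendsto (fun z => z / ((z + p) * (z + q))) atTop (𝓝 0) := by
  have hzero : ∀ t : ℝ, Tendsto (fun z => (z + t)⁻¹) atTop (𝓝 0) := fun t =>
    tendsto_inv_atTop_zero.comp (tendsto_atTop_add_const_right _ _ tendsto_id)
  have h := (hzero q).sub (((hzero p).const_mul p).mul (hzero q))
  rw [mul_zero, sub_zero] at h
  refine h.congr' ?_
  filter_upwards [eventually_gt_atTop (-p)] with z hz
  have hzp : z + p ≠ 0 := by linarith
  rw [mul_comm (z + p), ← div_div, inv_eq_one_div]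
  field

theorem prod_Gamma_dixon {a : ℝ} (ha : ∀ m : ℕ, a ≠ -m) (b c : ℝ) :
    ∏ i, Real.Gamma (![(1 + a - b) / 2, (2 + a - b) / 2, (1 + a - c) / 2, (2 + a - c) / 2,
        1 + a / 2 - b - c] i) /
      Real.Gamma (![(1 + a) / 2, 1 + a / 2 - b, 1 + a / 2 - c, (1 + a - b - c) / 2,
        (2 + a - b - c) / 2] i) =
    Real.Gamma (1 + a / 2) * Real.Gamma (1 + a - b) * Real.Gamma (1 + a - c) *
        Real.Gamma (1 + a / 2 - b - c) /
      (Real.Gamma (1 + a) * Real.Gamma (1 + a / 2 - b) * Real.Gamma (1 + a / 2 - c) *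
        Real.Gamma (1 + a - b - c)) := by
  have hdup : ∀ z w : ℝ, w = z + 1 → Real.Gamma (z / 2) * Real.Gamma (w / 2) =
      Real.Gamma z * 2 ^ (1 - z) * √Real.pi := fun z w hw => by
    have h := Real.Gamma_mul_Gamma_add_half (z / 2)
    rwa [mul_div_cancel₀ z two_ne_zero, ← add_div, ← hw] at h
  have hhalf : Real.Gamma (1 + a / 2) ≠ 0 := Real.Gamma_ne_zero fun m hm =>
    ha (2 * (m + 1)) (by push_cast; linarith)
  have hpow : (2 : ℝ) ^ (1 - (1 + a - b)) * 2 ^ (1 - (1 + a - c)) =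
      2 ^ (1 - (1 + a)) * 2 ^ (1 - (1 + a - b - c)) := by
    rw [← Real.rpow_add two_pos, ← Real.rpow_add two_pos]
    ring_nf
  have h₀ := hdup (1 + a) (2 + a) (by ring)
  rw [show (2 + a) / 2 = 1 + a / 2 by ring] at h₀
  simp only [Fin.prod_univ_five, Matrix.cons_val, div_mul_div_comm]
  rw [hdup (1 + a - b) (2 + a - b) (by ring), mul_assoc (_ * _) _ (Real.Gamma ((2 + a - c) / 2)),
    hdup (1 + a - c) _ (by ring), mul_assoc (_ * _) _ (Real.Gamma ((2 + a - b - c) / 2)),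
    hdup (1 + a - b - c) _ (by ring), eq_div_of_mul_eq hhalf h₀]
  have hne : (2 : ℝ) ^ (1 - (1 + a)) * 2 ^ (1 - (1 + a - b - c)) * (√Real.pi * √Real.pi) ≠ 0 := by
    positivity
  conv_rhs => rw [← mul_div_mul_right _ _ hne]; enter [1]; rw [← hpow]
  simp only [div_eq_mul_inv, mul_inv, inv_inv]
  ring

theorem dixonTerm_ratio (a b c n : ℝ) :
    ∏ i, (![a, b, c] i + n) / (![1 + a - b, 1 + a - c, 1] i + n) =
      (a + n) / ((a + n + (1 - b)) * (a + n + (1 - c))) * ((b + n) * (c + n) / (1 + n)) := by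
  simp only [Fin.prod_univ_three, Matrix.cons_val, div_eq_mul_inv, mul_inv]
  ring

theorem exists_forall_abs_dixonTerm_ratio_le (a b c : ℝ) : ∃ J : ℕ, ∀ j ≥ J, ∀ n : ℕ,
    |∏ i, (![a + 2 * j, b, c] i + n) / (![1 + (a + 2 * j) - b, 1 + (a + 2 * j) - c, 1] i + n)| ≤
      |∏ i, (![a + 2 * J, b, c] i + n) /
        (![1 + (a + 2 * J) - b, 1 + (a + 2 * J) - c, 1] i + n)| := by
  obtain ⟨J, hJ⟩ := exists_nat_gt (|1 - b| + |1 - c| - a)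
  refine ⟨J, fun j hj n => ?_⟩
  have hJn : |1 - b| + |1 - c| < a + 2 * J + n := by
    linarith [J.cast_nonneg (α := ℝ), n.cast_nonneg (α := ℝ)]
  have hJj : a + 2 * J + n ≤ a + 2 * j + n := by gcongr
  rw [dixonTerm_ratio, dixonTerm_ratio, abs_mul, abs_mul]
  exact mul_le_mul_of_nonneg_right
    (antitoneOn_abs_div_add_mul_add _ _ hJn (hJn.trans_le hJj) hJj) (abs_nonneg _)

theorem tendsto_dixonTerm_ratio (a b c : ℝ) (n : ℕ) :
    Tendsto (fun j : ℕ => ∏ i, (![a + 2 * j, b, c] i + n) /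
      (![1 + (a + 2 * j) - b, 1 + (a + 2 * j) - c, 1] i + n)) atTop (𝓝 0) := by
  simp only [dixonTerm_ratio]
  rw [← zero_mul ((b + n) * (c + n) / (1 + n))]
  refine ((tendsto_div_add_mul_add_atTop _ _).comp ?_).mul_const _
  exact tendsto_atTop_add_const_right _ _ (tendsto_atTop_add_const_left _ _
    (tendsto_natCast_atTop_atTop.const_mul_atTop two_pos))

theorem prod_dixon_ratio (a b c t : ℝ) :
    ∏ i, (![(1 + a) / 2, 1 + a / 2 - b, 1 + a / 2 - c, (1 + a - b - c) / 2,
        (2 + a - b - c) / 2] i + t) /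
      (![(1 + a - b) / 2, (2 + a - b) / 2, (1 + a - c) / 2, (2 + a - c) / 2,
        1 + a / 2 - b - c] i + t) =
    (a + 2 * t + 1) * (2 + (a + 2 * t) - 2 * b) * (2 + (a + 2 * t) - 2 * c) *
        (1 + (a + 2 * t) - b - c) * (2 + (a + 2 * t) - b - c) /
      ((1 + (a + 2 * t) - b) * (1 + (a + 2 * t) - b + 1) * (1 + (a + 2 * t) - c) *
        (1 + (a + 2 * t) - c + 1) * (2 + (a + 2 * t) - 2 * b - 2 * c)) := by
  rw [Finset.prod_congr rfl fun i _ => (mul_div_mul_left _ _ (two_ne_zero' ℝ)).symm,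
    Finset.prod_div_distrib, Fin.prod_univ_five, Fin.prod_univ_five]
  simp only [Matrix.cons_val]
  congr 1 <;> ring

theorem hasSum_hypergeometricTerm_dixon {a b c : ℝ} (ha : ∀ m : ℕ, a ≠ -m)
    (hb : ∀ m : ℕ, 1 + a - b ≠ -m) (hc : ∀ m : ℕ, 1 + a - c ≠ -m) (h : b + c < 1 + a / 2) :
    HasSum (hypergeometricTerm ![a, b, c] ![1 + a - b, 1 + a - c, 1])
      (Real.Gamma (1 + a / 2) * Real.Gamma (1 + a - b) * Real.Gamma (1 + a - c) *
          Real.Gamma (1 + a / 2 - b - c) /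
        (Real.Gamma (1 + a) * Real.Gamma (1 + a / 2 - b) * Real.Gamma (1 + a / 2 - c) *
          Real.Gamma (1 + a - b - c))) := by
  have hexcess : ∀ j : ℕ, 0 < 2 + (a + 2 * j) - 2 * b - 2 * c := fun j => by
    linarith [j.cast_nonneg (α := ℝ)]
  have haj : ∀ j m : ℕ, a + 2 * j ≠ -m := fun j m hm => ha (2 * j + m) (by push_cast; linarith)
  have hbj : ∀ j m : ℕ, 1 + (a + 2 * j) - b ≠ -m := fun j m hm =>
    hb (2 * j + m) (by push_cast; linarith)
  have hcj : ∀ j m : ℕ, 1 + (a + 2 * j) - c ≠ -m := fun j m hm =>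
    hc (2 * j + m) (by push_cast; linarith)
  rw [← prod_Gamma_dixon ha]
  have key := hasSum_hypergeometricTerm_of_contiguous_relation
    (x := fun j => ![a + 2 * j, b, c])
    (y := fun j => ![1 + (a + 2 * j) - b, 1 + (a + 2 * j) - c, 1])
    (p := ![(1 + a) / 2, 1 + a / 2 - b, 1 + a / 2 - c, (1 + a - b - c) / 2, (2 + a - b - c) / 2])
    (q := ![(1 + a - b) / 2, (2 + a - b) / 2, (1 + a - c) / 2, (2 + a - c) / 2,
        1 + a / 2 - b - c])
    (C := fun j n => dixonCertificate (a + 2 * j) b c n) ?_ ?_ ?_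
    (fun j => ⟨_, tendsto_dixonCertificate _ b c⟩) (exists_forall_abs_dixonTerm_ratio_le a b c)
    (tendsto_dixonTerm_ratio a b c) ?_ ?_
  · simpa only [Nat.cast_zero, mul_zero, add_zero] using key
  · exact fun j => Fin.forall_fin_succ.mpr ⟨hbj j, Fin.forall_fin_two.mpr
      ⟨hcj j, ne_neg_natCast_of_pos one_pos⟩⟩
  · intro j
    simp only [Fin.sum_univ_three, Matrix.cons_val]
    linarith [hexcess j]
  · intro j n
    rw [← dixon_contiguous_relation (haj j) (hbj j) (hcj j) (hexcess j).ne', prod_dixon_ratio,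
      show a + 2 * ((j + 1 : ℕ) : ℝ) = a + 2 * j + 2 by push_cast; ring]
  · simp only [Fin.forall_fin_succ]
    exact ⟨fun m (hm : (1 + a - b) / 2 = -m) => hb (2 * m) (by push_cast; linarith),
      fun m (hm : (2 + a - b) / 2 = -m) => hb (2 * m + 1) (by push_cast; linarith),
      fun m (hm : (1 + a - c) / 2 = -m) => hc (2 * m) (by push_cast; linarith),
      fun m (hm : (2 + a - c) / 2 = -m) => hc (2 * m + 1) (by push_cast; linarith),
      ne_neg_natCast_of_pos (a := 1 + a / 2 - b - c) (by linarith), nofun⟩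
  · simp only [Fin.sum_univ_five, Matrix.cons_val]
    ring

end GaussDixon

section CentralRatio

theorem centralRatio_eq (n : ℕ) :
    centralRatio n = risingFactorial (1 / 2) n / risingFactorial 1 n := by
  induction n with
  | zero => simp [centralRatio, risingFactorial_zero]
  | succ n ih =>
    have h : ((n : ℝ) + 1) * (Nat.choose (2 * (n + 1)) (n + 1) : ℝ) =
        2 * (2 * n + 1) * (Nat.choose (2 * n) n : ℝ) := by
      exact_mod_cast Nat.succ_mul_centralBinom_succ n
    rw [risingFactorial_succ, risingFactorial_succ, mul_div_mul_comm, ← ih, centralRatio,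
      centralRatio, div_mul_div_comm, div_eq_div_iff (by positivity) (by positivity), pow_succ]
    linear_combination (4 ^ n : ℝ) * h

theorem half_sub_natCast_ne_neg_natCast (n m : ℕ) : (1 / 2 - n : ℝ) ≠ -m := fun h => by
  have h' : (2 * m + 1 : ℝ) = 2 * n := by linarith
  norm_cast at h'
  lia

theorem centralRatio_div_eq (n k : ℕ) :
    centralRatio n / (risingFactorial (n + 1) k * risingFactorial (1 / 2 - n) k) =
      risingFactorial (1 / 2 - k) n / risingFactorial (k + 1) n /
        (risingFactorial 1 k * risingFactorial (1 / 2) k) := by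
  have h₁ : risingFactorial 1 n * risingFactorial (n + 1) k =
      risingFactorial 1 k * risingFactorial (k + 1) n := by
    rw [add_comm (n : ℝ), add_comm (k : ℝ), ← risingFactorial_add, ← risingFactorial_add,
      add_comm n]
  have h₂ : risingFactorial (1 / 2 - n) k * risingFactorial (1 / 2 - k) n =
      risingFactorial (1 / 2) k * risingFactorial (1 / 2) n := by
    have h := risingFactorial_sub_natCast_mul (1 / 2) k n
    rwa [sub_half] at h
  have hpos : ∀ {a : ℝ} (m : ℕ), 0 < a → risingFactorial a m ≠ 0 := fun m ha =>
    risingFactorial_ne_zero (ne_neg_natCast_of_pos ha) m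
  have hneg := risingFactorial_ne_zero (half_sub_natCast_ne_neg_natCast n) k
  rw [centralRatio_eq, div_div, div_div, ← mul_assoc, h₁, div_eq_div_iff
    (mul_ne_zero (mul_ne_zero (hpos k one_pos) (hpos n (by positivity))) hneg)
    (mul_ne_zero (hpos n (by positivity)) (mul_ne_zero (hpos k one_pos) (hpos k (by positivity))))]
  linear_combination -risingFactorial 1 k * risingFactorial (k + 1) n * h₂

theorem centralRatio_cube_div_eq (n k : ℕ) :
    centralRatio n ^ 3 / (risingFactorial (n + 1) k * risingFactorial (1 / 2 - n) k) =
      hypergeometricTerm ![1 / 2, 1 / 2, 1 / 2 - k]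
        ![1 + 1 / 2 - 1 / 2, 1 + 1 / 2 - (1 / 2 - k), 1] n /
        (risingFactorial 1 k * risingFactorial (1 / 2) k) := by
  rw [pow_succ, mul_div_assoc, centralRatio_div_eq, centralRatio_eq]
  simp only [hypergeometricTerm, Fin.prod_univ_three, Matrix.cons_val, add_sub_cancel_right,
    show (1 + 1 / 2 - (1 / 2 - k) : ℝ) = k + 1 by ring]
  ring

theorem centralRatio_sq_div_eq (n k : ℕ) :
    centralRatio n ^ 2 / (risingFactorial (n + 1) k * risingFactorial (1 / 2 - n) k) =
      hypergeometricTerm ![1 / 2, 1 / 2 - k] ![(k + 1 : ℝ), 1] n /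
        (risingFactorial 1 k * risingFactorial (1 / 2) k) := by
  rw [pow_two, mul_div_assoc, centralRatio_div_eq, centralRatio_eq]
  simp only [hypergeometricTerm, Fin.prod_univ_two, Matrix.cons_val_zero, Matrix.cons_val_one]
  ring

theorem risingFactorial_one_mul_half (k : ℕ) :
    risingFactorial 1 k * risingFactorial (1 / 2) k =
      Real.Gamma (k + 1) * Real.Gamma (k + 1 / 2) / √Real.pi := by
  rw [add_comm (k : ℝ), add_comm (k : ℝ), Gamma_add_natCast (ne_neg_natCast_of_pos one_pos),
    Gamma_add_natCast (ne_neg_natCast_of_pos one_half_pos), Real.Gamma_one, Real.Gamma_one_half_eq,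
    mul_one, ← mul_assoc, mul_div_cancel_right₀ _ (by positivity)]

theorem Gamma_three_quarters :
    Real.Gamma (3 / 4) = Real.pi * √2 / Real.Gamma (1 / 4) := by
  have h := Real.Gamma_mul_Gamma_one_sub (1 / 4)
  rw [show (1 : ℝ) - 1 / 4 = 3 / 4 by norm_num, mul_one_div, Real.sin_pi_div_four] at h
  rw [eq_div_of_mul_eq (by positivity) ((mul_comm _ _).trans h)]
  field_simp
  norm_num

theorem hasSum_centralRatio_cube_div (k : ℕ) :
    HasSum (fun n : ℕ => centralRatio n ^ 3 /
        (risingFactorial (n + 1) k * risingFactorial (1 / 2 - n) k))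
      (Real.Gamma (1 / 4) ^ 2 / (2 * Real.pi * √2) *
        (Real.Gamma (k + 1 / 4) / (Real.Gamma (k + 1 / 2) ^ 2 * Real.Gamma (k + 3 / 4)))) := by
  have hdixon := hasSum_hypergeometricTerm_dixon (a := 1 / 2) (b := 1 / 2) (c := 1 / 2 - k)
    (ne_neg_natCast_of_pos one_half_pos) (ne_neg_natCast_of_pos (by norm_num))
    (ne_neg_natCast_of_pos (by linarith [k.cast_nonneg (α := ℝ)]))
    (by linarith [k.cast_nonneg (α := ℝ)])
  have hfive : Real.Gamma (1 + 1 / 2 / 2) = 1 / 4 * Real.Gamma (1 / 4) := by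
    rw [← Real.Gamma_add_one (by norm_num)]
    norm_num
  have hthree_half : Real.Gamma (1 + 1 / 2) = 1 / 2 * √Real.pi := by
    rw [add_comm, Real.Gamma_add_one (by norm_num), Real.Gamma_one_half_eq]
  simp only [centralRatio_cube_div_eq]
  convert! hdixon.div_const _ using 1
  rw [risingFactorial_one_mul_half, hfive, hthree_half, add_sub_cancel_right, Real.Gamma_one,
    show (1 + 1 / 2 - (1 / 2 - k) : ℝ) = k + 1 by ring,
    show (1 + 1 / 2 / 2 - 1 / 2 - (1 / 2 - k) : ℝ) = k + 1 / 4 by ring,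
    show (1 + 1 / 2 / 2 - 1 / 2 : ℝ) = 3 / 4 by norm_num,
    show (1 + 1 / 2 / 2 - (1 / 2 - k) : ℝ) = k + 3 / 4 by ring,
    show (1 - (1 / 2 - k) : ℝ) = k + 1 / 2 by ring, Gamma_three_quarters]
  field_simp
  norm_num

theorem Gamma_duplication_quotient {s : ℝ} (hs : 0 < s) :
    √Real.pi * Real.Gamma (2 * s) / (Real.Gamma (s + 1 / 2) ^ 2 * Real.Gamma (2 * s + 1 / 2)) =
      2 ^ (8 * s - 3) * Real.Gamma s ^ 2 / (Real.pi * Real.Gamma (4 * s)) := by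
  have h₁ : Real.Gamma (s + 1 / 2) =
      Real.Gamma (2 * s) * 2 ^ (1 - 2 * s) * √Real.pi / Real.Gamma s :=
    eq_div_of_mul_eq (by positivity) (by rw [mul_comm, Real.Gamma_mul_Gamma_add_half])
  have h₂ : Real.Gamma (2 * s + 1 / 2) =
      Real.Gamma (4 * s) * 2 ^ (1 - 4 * s) * √Real.pi / Real.Gamma (2 * s) := by
    have h := Real.Gamma_mul_Gamma_add_half (2 * s)
    rw [show 2 * (2 * s) = 4 * s by ring] at h
    exact eq_div_of_mul_eq (by positivity) (by rw [mul_comm, h])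
  have hpow : (2 : ℝ) ^ (8 * s - 3) * ((2 ^ (1 - 2 * s)) ^ 2 * 2 ^ (1 - 4 * s)) = 1 := by
    rw [← Real.rpow_natCast, ← Real.rpow_mul zero_le_two, ← Real.rpow_add two_pos,
      ← Real.rpow_add two_pos]
    push_cast
    ring_nf
    exact Real.rpow_zero 2
  rw [h₁, h₂]
  have hx : (0 : ℝ) < 2 ^ (1 - 2 * s) := by positivity
  have hy : (0 : ℝ) < 2 ^ (1 - 4 * s) := by positivity
  generalize (2 : ℝ) ^ (1 - 2 * s) = x, (2 : ℝ) ^ (1 - 4 * s) = y,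
    (2 : ℝ) ^ (8 * s - 3) = z at hpow hx hy ⊢
  field_simp
  rw [Real.sq_sqrt Real.pi_pos.le]
  linear_combination -Real.pi * hpow

theorem hasSum_centralRatio_sq_div {k : ℕ} (hk : 1 ≤ k) :
    HasSum (fun n : ℕ => centralRatio n ^ 2 /
        (risingFactorial (n + 1) k * risingFactorial (1 / 2 - n) k))
      (2 ^ (8 * k - 3) * Real.Gamma k ^ 2 / (Real.pi * Real.Gamma (4 * k))) := by
  have hk' : (0 : ℝ) < k := Nat.cast_pos.mpr hk
  have hgauss := hasSum_hypergeometricTerm_gauss (a := 1 / 2) (b := 1 / 2 - k) (c := k + 1)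
    (ne_neg_natCast_of_pos (by positivity)) (by linarith)
  have hpow : (2 : ℝ) ^ (8 * k - 3) = 2 ^ (8 * (k : ℝ) - 3) := by
    rw [← Real.rpow_natCast, Nat.cast_sub (by lia)]
    norm_cast
  have hsum : √Real.pi * Real.Gamma (2 * k) /
      (Real.Gamma (k + 1 / 2) ^ 2 * Real.Gamma (2 * k + 1 / 2)) =
      Real.Gamma (k + 1) * Real.Gamma (k + 1 - 1 / 2 - (1 / 2 - k)) /
        (Real.Gamma (k + 1 - 1 / 2) * Real.Gamma (k + 1 - (1 / 2 - k))) /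
          (risingFactorial 1 k * risingFactorial (1 / 2) k) := by
    rw [risingFactorial_one_mul_half, show (k + 1 - 1 / 2 - (1 / 2 - k) : ℝ) = 2 * k by ring,
      show (k + 1 - 1 / 2 : ℝ) = k + 1 / 2 by ring,
      show (k + 1 - (1 / 2 - k) : ℝ) = 2 * k + 1 / 2 by ring]
    field_simp
  simp only [centralRatio_sq_div_eq]
  rw [hpow, ← Gamma_duplication_quotient hk', hsum]
  exact hgauss.div_const _

theorem exists_rat_hasSum_centralRatio_cube_div (k : ℕ) :
    ∃ q : ℚ, HasSum (fun n : ℕ => centralRatio n ^ 3 /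
        (risingFactorial (n + 1) k * risingFactorial (1 / 2 - n) k))
      (q * (Real.Gamma (1 / 4) ^ 4 / (8 * Real.pi ^ 3))) := by
  refine ⟨2 * (ascPochhammer ℚ k).eval (1 / 4) / ((ascPochhammer ℚ k).eval (1 / 2) ^ 2 *
    (ascPochhammer ℚ k).eval (3 / 4)), ?_⟩
  convert! hasSum_centralRatio_cube_div k using 1
  have hpos : ∀ {a : ℝ}, 0 < a → risingFactorial a k ≠ 0 := fun ha =>
    risingFactorial_ne_zero (ne_neg_natCast_of_pos ha) k
  have hquarter := risingFactorial_ratCast (1 / 4) k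
  have hhalf := risingFactorial_ratCast (1 / 2) k
  have hthree := risingFactorial_ratCast (3 / 4) k
  push_cast at hquarter hhalf hthree ⊢
  rw [add_comm (k : ℝ), add_comm (k : ℝ), add_comm (k : ℝ),
    Gamma_add_natCast (ne_neg_natCast_of_pos (by norm_num)),
    Gamma_add_natCast (ne_neg_natCast_of_pos one_half_pos),
    Gamma_add_natCast (ne_neg_natCast_of_pos (by norm_num)), Real.Gamma_one_half_eq,
    Gamma_three_quarters, ← hquarter, ← hhalf, ← hthree, mul_pow _ √Real.pi,
    Real.sq_sqrt Real.pi_pos.le]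
  have hhalf₀ := hpos one_half_pos
  have hthree₀ := hpos (a := 3 / 4) (by norm_num)
  field_simp
  rw [Real.sq_sqrt zero_le_two]
  ring

theorem exists_rat_hasSum_centralRatio_sq_div {k : ℕ} (hk : 1 ≤ k) :
    ∃ q : ℚ, HasSum (fun n : ℕ => centralRatio n ^ 2 /
        (risingFactorial (n + 1) k * risingFactorial (1 / 2 - n) k))
      (q * (1 / Real.pi)) := by
  refine ⟨2 ^ (8 * k - 3) * ((k - 1).factorial : ℚ) ^ 2 / ((4 * k - 1).factorial : ℚ), ?_⟩
  convert! hasSum_centralRatio_sq_div hk using 1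
  have hGamma : ∀ {m : ℕ}, 1 ≤ m → Real.Gamma m = (m - 1).factorial := fun {m} hm => by
    rw [← Real.Gamma_nat_eq_factorial, Nat.cast_sub hm, Nat.cast_one, sub_add_cancel]
  have hGamma₄ := hGamma (m := 4 * k) (by lia)
  push_cast at hGamma₄ ⊢
  rw [hGamma hk, hGamma₄, mul_one_div, div_div, mul_comm Real.pi]

end CentralRatio

section RationalSums

/-- The sequences `f` for which the series `∑ f n * w n` converges to a rational multiple of `c`. -/
def rationalSums (w : ℕ → ℝ) (c : ℝ) : Submodule ℚ (ℕ → ℝ) where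
  carrier := {f | ∃ q : ℚ, HasSum (fun n => f n * w n) (q * c)}
  zero_mem' := ⟨0, by simp [hasSum_zero]⟩
  add_mem' := by
    rintro f g ⟨q, hq⟩ ⟨r, hr⟩
    exact ⟨q + r, by simpa [add_mul] using hq.add hr⟩
  smul_mem' := by
    rintro a f ⟨q, hq⟩
    refine ⟨a * q, ?_⟩
    simpa [Rat.smul_def, mul_assoc] using hq.mul_left (a : ℝ)

theorem prod_eq_add_smul_prod {R A : Type*} [CommRing R] [CommRing A] [Algebra R A]
    {r : ℕ → A} {e : ℕ → R} (hr : ∀ i j, r i - r j = (e j - e i) • (r i * r j)) {S : Finset ℕ}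
    {i j : ℕ} (hi : i ∈ S) (hj : j ∉ S) :
    ∏ m ∈ S, r m =
      ∏ m ∈ insert j (S.erase i), r m + (e j - e i) • ∏ m ∈ insert j S, r m := by
  rw [Finset.prod_insert hj, Finset.prod_insert fun h => hj (Finset.mem_of_mem_erase h),
    ← Finset.mul_prod_erase S r hi, mul_left_comm, ← mul_assoc (r i), ← smul_mul_assoc, ← hr]
  ring

theorem prod_mem_of_prod_range_mem {R A : Type*} [CommRing R] [CommRing A] [Algebra R A]
    {V : Submodule R A} {r : ℕ → A} {e : ℕ → R}
    (hr : ∀ i j, r i - r j = (e j - e i) • (r i * r j)) {k₀ : ℕ}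
    (hV : ∀ k ≥ k₀, ∏ m ∈ Finset.range k, r m ∈ V) {S : Finset ℕ} (hS : k₀ ≤ S.card) :
    ∏ m ∈ S, r m ∈ V := by
  -- Induction on the number `g` of gaps of `S` in `range M`: the resolvent identity fills a gap,
  -- either keeping the largest element of `S` or dropping it.
  suffices H : ∀ g M : ℕ, ∀ S ⊆ Finset.range M, k₀ ≤ S.card → S.card + g = M →
      ∏ m ∈ S, r m ∈ V by
    obtain ⟨M, hM⟩ := S.exists_nat_subset_range
    exact H (M - S.card) M S hM hS (Nat.add_sub_of_le (by simpa using Finset.card_le_card hM))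
  intro g
  induction g with
  | zero =>
    intro M S hSM hcard hM
    rw [Finset.eq_of_subset_of_card_le hSM (by simp [← hM])]
    exact hV M (hM ▸ hcard)
  | succ g ih =>
    rintro M S hSM hcard rfl
    rw [← add_assoc, Finset.range_add_one] at hSM
    by_cases htop : S.card + g ∈ S
    · obtain ⟨m, hm, hmS⟩ := Finset.exists_mem_notMem_of_card_lt_card
        (show S.card < (Finset.range (S.card + g + 1)).card by simp)
      have hm' : m ∈ Finset.range (S.card + g) := by grind
      have hcard₁ : (insert m (S.erase (S.card + g))).card = S.card := by grind
      have hcard₂ : (insert m S).card = S.card + 1 := Finset.card_insert_of_notMem hmS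
      rw [prod_eq_add_smul_prod hr htop hmS]
      refine V.add_mem (ih (S.card + g) _ ?_ (hcard.trans_eq hcard₁.symm) (by rw [hcard₁]))
        (V.smul_mem _ (ih (S.card + g + 1) _ ?_ (by lia) (by lia)))
      · exact Finset.insert_subset hm' (Finset.subset_insert_iff.mp hSM)
      · exact Finset.insert_subset hm (hSM.trans_eq Finset.range_add_one.symm)
    · exact ih _ S ((Finset.subset_insert_iff_of_notMem htop).mp hSM) hcard rfl

/-- The reciprocal of the `m`-th factor `(n + 1 + m) * (1 / 2 - n + m)` of
`(n + 1)_k * (1 / 2 - n)_k`. -/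
noncomputable def factorReciprocal (m n : ℕ) : ℝ := ((n + 1 + m) * (1 / 2 - n + m))⁻¹

theorem factor_ne_zero (m n : ℕ) : ((n + 1 + m) * (1 / 2 - n + m) : ℝ) ≠ 0 :=
  mul_ne_zero (by positivity) (add_natCast_ne_zero (half_sub_natCast_ne_neg_natCast n) m)

-- The factors are `(m + 1) * (m + 1 / 2) - n * (n + 1 / 2)`, so this is a resolvent identity.
theorem factorReciprocal_sub_factorReciprocal (i j : ℕ) :
    factorReciprocal i - factorReciprocal j =
      (((j + 1) * (j + 1 / 2) - (i + 1) * (i + 1 / 2) : ℚ)) •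
        (factorReciprocal i * factorReciprocal j) := by
  ext n
  rw [Pi.sub_apply, Pi.smul_apply, Pi.mul_apply, Rat.smul_def]
  simp only [factorReciprocal]
  rw [inv_sub_inv (factor_ne_zero i n) (factor_ne_zero j n), ← mul_inv, div_eq_mul_inv]
  push_cast
  ring

theorem prod_range_factorReciprocal_apply (k n : ℕ) :
    (∏ m ∈ Finset.range k, factorReciprocal m) n =
      1 / (risingFactorial (n + 1) k * risingFactorial (1 / 2 - n) k) := by
  rw [Finset.prod_apply, one_div, risingFactorial_eq_prod_range, risingFactorial_eq_prod_range,
    ← Finset.prod_mul_distrib, ← Finset.prod_inv_distrib]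
  rfl

theorem prod_factorReciprocal_mem_rationalSums {w : ℕ → ℝ} {c : ℝ} {k₀ : ℕ}
    (h : ∀ k ≥ k₀, ∃ q : ℚ, HasSum (fun n : ℕ => w n /
      (risingFactorial (n + 1) k * risingFactorial (1 / 2 - n) k)) (q * c))
    {S : Finset ℕ} (hS : k₀ ≤ S.card) :
    ∏ m ∈ S, factorReciprocal m ∈ rationalSums w c := by
  refine prod_mem_of_prod_range_mem (e := fun m : ℕ => ((m + 1) * (m + 1 / 2) : ℚ))
    factorReciprocal_sub_factorReciprocal (fun k hk => ?_) hS
  obtain ⟨q, hq⟩ := h k hk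
  exact ⟨q, by simpa only [prod_range_factorReciprocal_apply, one_div_mul_eq_div] using hq⟩

end RationalSums

section AdmissiblePolynomials

open Polynomial

theorem admissibleRoots_eq_range :
    admissibleRoots =
      Set.range (Sum.elim (fun m : ℕ => -((m : ℂ) + 1)) fun m : ℕ => (m : ℂ) + 1 / 2) := by
  ext z
  simp only [admissibleRoots, Set.mem_ofPred_eq, Set.Sum.elim_range, Set.mem_union, Set.mem_range,
    eq_comm]

theorem injective_admissibleRoot : Function.Injective
    (Sum.elim (fun m : ℕ => -((m : ℂ) + 1)) fun m : ℕ => (m : ℂ) + 1 / 2) := by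
  refine Function.Injective.sumElim (fun i j h => by simpa using h) (fun i j h => by simpa using h)
    fun i j h => ?_
  have h' : ((2 * i + 2 * j + 3 : ℕ) : ℂ) = 0 := by
    push_cast
    linear_combination -2 * h
  exact absurd (Nat.cast_eq_zero.mp h') (by lia)

namespace IsAdmissible

variable {p : ℚ[X]}

theorem aeval_neg_half_sub (hp : IsAdmissible p) (z : ℂ) :
    aeval (-1 / 2 - z) p = aeval z p := by
  conv_rhs => rw [← hp.symmetric, aeval_comp]
  simp

theorem exists_eq_prod (hp : IsAdmissible p) :
    ∃ S : Finset ℕ, p = C p.leadingCoeff *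
      ∏ m ∈ S, ((X + C (m + 1 : ℚ)) * (X - C (m + 1 / 2 : ℚ))) := by
  set ρ : ℕ ⊕ ℕ → ℂ := Sum.elim (fun m : ℕ => -((m : ℂ) + 1)) fun m : ℕ => (m : ℂ) + 1 / 2
  have hρ : ρ.Injective := injective_admissibleRoot
  set T : Finset (ℕ ⊕ ℕ) := (p.aroots ℂ).toFinset.preimage ρ hρ.injOn with hT
  have hmem : ∀ t, t ∈ T ↔ aeval (ρ t) p = 0 := fun t => by
    rw [hT, Finset.mem_preimage, Multiset.mem_toFinset, mem_aroots, and_iff_right hp.ne_zero]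
  have hsymm : T.toRight = T.toLeft := by
    ext m
    rw [Finset.mem_toRight, Finset.mem_toLeft, hmem, hmem, ← hp.aeval_neg_half_sub]
    simp only [ρ, Sum.elim_inl, Sum.elim_inr]
    ring_nf
  refine ⟨T.toLeft, map_injective _ (algebraMap ℚ ℂ).injective ?_⟩
  rw [(IsAlgClosed.splits (p.map (algebraMap ℚ ℂ))).eq_prod_roots]
  have hprod : ((p.aroots ℂ).map (X - C ·)).prod = ∏ t ∈ T, (X - C (ρ t)) := by
    rw [Finset.prod_preimage ρ _ hρ.injOn (fun z => X - C z), Finset.prod, Multiset.toFinset_val,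
      hp.simple_roots.dedup]
    intro z hz hz'
    exact absurd (admissibleRoots_eq_range ▸ hp.roots_mem z (Multiset.mem_toFinset.mp hz)) hz'
  have hpair : ∏ t ∈ T, (X - C (ρ t)) =
      ∏ m ∈ T.toLeft, ((X + C ((m : ℂ) + 1)) * (X - C ((m : ℂ) + 1 / 2))) := by
    conv_lhs => rw [← T.toLeft_disjSum_toRight, Finset.prod_disjSum, hsymm]
    simp only [ρ, Sum.elim_inl, Sum.elim_inr, C_neg, sub_neg_eq_add, Finset.prod_mul_distrib]
  rw [← aroots, hprod, hpair, Polynomial.map_mul, map_C, Polynomial.map_prod, leadingCoeff_map]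
  simp

theorem one_div_aeval_mem_rationalSums (hp : IsAdmissible p) {w : ℕ → ℝ} {c : ℝ} {k₀ : ℕ}
    (hk₀ : 2 * k₀ ≤ p.natDegree)
    (h : ∀ k ≥ k₀, ∃ q : ℚ, HasSum (fun n : ℕ => w n /
      (risingFactorial (n + 1) k * risingFactorial (1 / 2 - n) k)) (q * c)) :
    (fun n : ℕ => 1 / aeval (n : ℝ) p) ∈ rationalSums w c := by
  obtain ⟨S, hS⟩ := hp.exists_eq_prod
  have hdeg : p.natDegree ≤ 2 * S.card := by
    rw [hS, mul_comm 2, ← smul_eq_mul]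
    refine (natDegree_C_mul_le _ _).trans <| (natDegree_prod_le _ _).trans <|
      Finset.sum_le_card_nsmul _ _ _ fun m _ => ?_
    compute_degree
  have hinv : (fun n : ℕ => 1 / aeval (n : ℝ) p) =
      (p.leadingCoeff * (-1) ^ S.card)⁻¹ • ∏ m ∈ S, factorReciprocal m := by
    ext n
    have hp_eval : aeval (n : ℝ) p = p.leadingCoeff * ((-1) ^ S.card *
        ∏ m ∈ S, ((n + 1 + m) * (1 / 2 - n + m) : ℝ)) := by
      rw [← Finset.prod_const, ← Finset.prod_mul_distrib]
      conv_lhs => rw [hS, map_mul, aeval_C, map_prod]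
      refine congrArg (_ * ·) (Finset.prod_congr rfl fun m _ => ?_)
      simp only [map_mul, map_add, map_sub, aeval_X, aeval_C, eq_ratCast]
      push_cast
      ring
    rw [hp_eval, Pi.smul_apply, Finset.prod_apply, Rat.smul_def]
    simp only [factorReciprocal, Finset.prod_inv_distrib]
    rw [one_div, ← mul_assoc, mul_inv]
    push_cast
    rfl
  rw [hinv]
  exact Submodule.smul_mem _ _ (prod_factorReciprocal_mem_rationalSums h (by lia))

end IsAdmissible

end AdmissiblePolynomials

theorem mainTheorem4 :
    (∀ k : ℕ, 1 ≤ k →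
      HasSum
        (fun n : ℕ => centralRatio n ^ 3 /
          (risingFactorial ((n : ℝ) + 1) k * risingFactorial (1 / 2 - (n : ℝ)) k))
        (Real.Gamma (1 / 4) ^ 2 / (2 * Real.pi * Real.sqrt 2) *
          (Real.Gamma ((k : ℝ) + 1 / 4) /
            (Real.Gamma ((k : ℝ) + 1 / 2) ^ 2 * Real.Gamma ((k : ℝ) + 3 / 4)))) ∧
      HasSum
        (fun n : ℕ => centralRatio n ^ 2 /
          (risingFactorial ((n : ℝ) + 1) k * risingFactorial (1 / 2 - (n : ℝ)) k))
        (2 ^ (8 * k - 3) * Real.Gamma (k : ℝ) ^ 2 / (Real.pi * Real.Gamma (4 * (k : ℝ))))) ∧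
    (∀ p : Polynomial ℚ, IsAdmissible p →
      (∃ q : ℚ, HasSum
        (fun n : ℕ => 1 / (Polynomial.aeval (n : ℝ) p) * centralRatio n ^ 3)
        ((q : ℝ) * (Real.Gamma (1 / 4) ^ 4 / (8 * Real.pi ^ 3)))) ∧
      (0 < p.natDegree → ∃ q : ℚ, HasSum
        (fun n : ℕ => 1 / (Polynomial.aeval (n : ℝ) p) * centralRatio n ^ 2)
        ((q : ℝ) * (1 / Real.pi)))) := by
  refine ⟨fun k hk => ⟨hasSum_centralRatio_cube_div k, hasSum_centralRatio_sq_div hk⟩,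
    fun p hp => ⟨?_, fun hdeg => ?_⟩⟩
  · exact hp.one_div_aeval_mem_rationalSums (k₀ := 0) (Nat.zero_le _) fun k _ =>
      exists_rat_hasSum_centralRatio_cube_div k
  · have hdeg₂ : 2 * 1 ≤ p.natDegree := Nat.le_of_dvd hdeg hp.even_degree.two_dvd
    exact hp.one_div_aeval_mem_rationalSums hdeg₂ fun k hk =>
      exists_rat_hasSum_centralRatio_sq_div hk
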